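/- Let $n\ge 0$ and $d\ge 2$ be integers. There is a constant $C=C(n,d)$, depending only on $n$ and $d$, with the following property. Let $p$ be a prime and let $F\in\mathbb{F}_p[x_1,\dots,x_n]$ be a nonsingular form of degree $d$, i.e. a homogeneous polynomial of degree $d$ such that $F$ and all its partial derivatives have no common zero in $\overline{\mathbb{F}}_p^{\,n}$ other than the origin. For $\mathbf{h}\in\mathbb{Z}^n$ put $G_{\mathbf h}=\mathbf{h}\cdot\nabla F=\sum_i h_i\,\partial F/\partial x_i\in\mathbb{F}_p[x_1,\dots,x_n]$, and let the singular locus of the affine variety $G_{\mathbf h}=0$ be the Zariski closed set $$\{\mathbf{x}\in\overline{\mathbb{F}}_p^{\,n}: G_{\mathbf h}(\mathbf{x})=0,\ \nabla G_{\mathbf h}(\mathbf{x})=\mathbf{0}\}$$ (so it is all of affine $n$-space when $G_{\mathbf h}$ is the zero polynomial). Then for every positive integer $H$ and every integer $s$ with $0\le s\le n$, the number of non-zero $\mathbf{h}\in\mathbb{Z}^n\cap[-H,H]^n$ for which this singular locus has affine dimension exactly $s$ is at most $$C\left(H^{n-s}+H^{n}p^{-s}\right).$$ -/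

import Mathlib

open MvPolynomial

noncomputable section

/-- A form `F` over a field `k` is nonsingular if `F` and its partial derivatives have no common
zero other than the origin with coordinates in the algebraic closure of `k`. -/
def IsNonsingularForm {k : Type*} [Field k] {n : ℕ} (F : MvPolynomial (Fin n) k) : Prop :=
  ∀ x : Fin n → AlgebraicClosure k,
    aeval x F = 0 → (∀ i, aeval x (pderiv i F) = 0) → x = 0

/-- The polynomial `h · ∇F` over `𝔽_p`, for an integer vector `h` (reduced modulo `p`). -/
def dotGrad {p n : ℕ} (h : Fin n → ℤ) (F : MvPolynomial (Fin n) (ZMod p)) :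
    MvPolynomial (Fin n) (ZMod p) :=
  ∑ i, C ((h i : ℤ) : ZMod p) * pderiv i F

/-- The singular locus of the affine variety `G = 0`, as the set of its geometric points: the
common zeros of `G` and of all its partial derivatives. If `G = 0` as a polynomial, this is the
whole affine space. -/
def singularLocus {k : Type*} [Field k] {n : ℕ} (G : MvPolynomial (Fin n) k) :
    Set (Fin n → AlgebraicClosure k) :=
  {x | aeval x G = 0 ∧ ∀ i, aeval x (pderiv i G) = 0}

/-- The (affine) dimension of a Zariski closed subset of affine `n`-space over a field: the Krull
dimension of its coordinate ring. The empty set has dimension `⊥`. -/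
def affineDim {K : Type*} [Field K] {n : ℕ} (V : Set (Fin n → K)) : WithBot ℕ∞ :=
  ringKrullDim (MvPolynomial (Fin n) K ⧸ vanishingIdeal K V)

end

/-! For `p ≤ d` the factor `p ^ (-s)` is bounded below in terms of `n` and `d`, so counting the
whole box suffices. Let `p > d`. A singular point `x` of `h · ∇F` satisfies `Hess F(x) h = 0`. The
cone of pairs `(x, h)` satisfying these equations has dimension at most `n`: on the diagonal `x =
h`, which is cut out by `n` linear equations, Euler's formula turns them into `(d - 1) ∇F(x) = 0`,
whose only solution is `0`. A fibre of dimension `s` over `h` therefore leaves only `n - s` degrees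
of freedom for `h`.

Since the constant may not depend on `p`, each dimension statement is replaced by polynomial
relations of bounded degree. An effective Nullstellensatz (`pow_mem_span_of_forall_eq_zero`) puts
bounded powers of the variables into the Jacobian ideal. Comparing numbers of monomials then gives a
bounded relation between any `n + 1` of the coordinates of `x` and `h`
(`exists_relation_of_hessian`). If `s` coordinates of `x` are independent on the singular locus, the
coefficients of such a relation must vanish, which constrains any `n - s + 1` coordinates of `h`
(`exists_polynomial_vanishing_of_independent`). The footprint bound turns this into a count of
residues of `h` modulo `p`, and the fibres of reduction modulo `p` are counted directly. -/

/-! ### Krull dimension and independent coordinates. -/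

/-- The Krull dimension of a finitely generated domain over a field is at most its transcendence
degree. -/
theorem exists_ringKrullDim_le_natCast_le_trdeg (K A : Type*) [Field K] [CommRing A] [IsDomain A]
    [Algebra K A] [Algebra.FiniteType K A] :
    ∃ r : ℕ, ringKrullDim A ≤ r ∧ (r : Cardinal) ≤ Algebra.trdeg K A := by
  -- Noether normalization: incomparability for the integral map `g` bounds the dimension by `r`,
  -- and injectivity of `g` bounds the transcendence degree below by `r`.
  obtain ⟨r, g, hinj, hint⟩ := exists_integral_inj_algHom_of_fg K A
  refine ⟨r, ?_, ?_⟩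
  · have h1 : ringKrullDim (MvPolynomial (Fin r) K) = r := by
      simp [MvPolynomial.ringKrullDim_of_isNoetherianRing, ringKrullDim_eq_zero_of_field]
    rw [← h1]
    algebraize [g.toRingHom]
    refine Order.krullDim_le_of_strictMono
      (PrimeSpectrum.comap (algebraMap (MvPolynomial (Fin r) K) A)) fun P Q h => ?_
    have : Algebra.IsIntegral (MvPolynomial (Fin r) K) A := ⟨hint⟩
    exact Ideal.IsIntegral.comap_lt_comap h
  · have := lift_trdeg_le_of_injective g hinj
    simpa using this

/-- A domain of Krull dimension at least `s` generated over a field by `x₁, …, xₙ` has `s`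
algebraically independent elements among the `xᵢ`. -/
theorem exists_algebraicIndependent_generators {K A : Type*} [Field K] [CommRing A] [IsDomain A]
    [Algebra K A] {n s : ℕ} (x : Fin n → A)
    (hx : Function.Surjective (aeval x : MvPolynomial (Fin n) K →ₐ[K] A))
    (hA : (s : WithBot ℕ∞) ≤ ringKrullDim A) :
    ∃ u : Fin s → Fin n, AlgebraicIndependent K (x ∘ u) := by
  have : Algebra.FiniteType K A := Algebra.FiniteType.of_surjective _ hx
  obtain ⟨r, hr, hrt⟩ := exists_ringKrullDim_le_natCast_le_trdeg K A
  have htop : Algebra.adjoin K (Set.range x) = ⊤ := by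
    rw [Algebra.adjoin_range_eq_range_aeval]
    exact (AlgHom.range_eq_top _).2 hx
  have halg : Algebra.IsAlgebraic (Algebra.adjoin K (Set.range x)) A := by
    constructor
    intro a
    exact isAlgebraic_algebraMap (⟨a, htop ▸ Algebra.mem_top⟩ : Algebra.adjoin K (Set.range x))
  obtain ⟨t, ht, hbasis⟩ := isAlgebraic_iff_exists_isTranscendenceBasis_subset.1 halg
  have hst : (s : Cardinal) ≤ Cardinal.mk t := by
    rw [hbasis.cardinalMk_eq_trdeg]
    refine le_trans ?_ hrt
    have := hA.trans hr
    exact_mod_cast this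
  obtain ⟨e⟩ : Nonempty (Fin s ↪ t) := by
    rw [← Cardinal.lift_mk_le']
    simpa using hst
  choose u hu using fun j : Fin s => ht (e j).2
  refine ⟨u, ?_⟩
  have : x ∘ u = (fun y : t => (y : A)) ∘ e := by
    funext j; exact hu j
  rw [this]
  exact hbasis.1.comp e e.injective

/-- If the quotient `K[x] / I` has Krull dimension at least `s`, then some `s` of the
coordinates are algebraically independent modulo `I`. -/
theorem exists_independent_coordinates {K : Type*} [Field K] {n s : ℕ}
    (I : Ideal (MvPolynomial (Fin n) K)) (hI : (s : WithBot ℕ∞) ≤ ringKrullDim (_ ⧸ I)) :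
    ∃ U : Finset (Fin n), U.card = s ∧
      ∀ P ∈ I, (∀ a ∈ P.support, a.support ⊆ U) → P = 0 := by
  classical
  obtain ⟨l, hl⟩ := Order.le_krullDim_iff.1 hI
  -- Dividing by the bottom prime of a chain of length `s` gives a domain, and the whole chain
  -- survives in it.
  have hA : (s : WithBot ℕ∞) ≤ ringKrullDim ((_ ⧸ I) ⧸ l.head.asIdeal) := by
    rw [ringKrullDim_quotient]
    refine Order.le_krullDim_iff.2 ⟨⟨l.length, fun i => ⟨l i, ?_⟩, fun i => l.step i⟩, hl⟩
    exact l.monotone (Fin.zero_le i)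
  let π : MvPolynomial (Fin n) K →ₐ[K] ((_ ⧸ I) ⧸ l.head.asIdeal) :=
    (Ideal.Quotient.mkₐ K _).comp (Ideal.Quotient.mkₐ K I)
  have hπ : Function.Surjective π :=
    (Ideal.Quotient.mkₐ_surjective K _).comp (Ideal.Quotient.mkₐ_surjective K I)
  have hx : aeval (fun i => π (X i)) = π := by
    ext i; simp
  obtain ⟨u, hind⟩ := exists_algebraicIndependent_generators (fun i => π (X i))
    (by rw [hx]; exact hπ) hA
  have huinj : Function.Injective u := hind.injective.of_comp
  refine ⟨Finset.univ.image u, ?_, fun P hP hPU => ?_⟩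
  · rw [Finset.card_image_of_injective _ huinj]; simp
  · have hv : (P.vars : Set (Fin n)) ⊆ Set.range u := by
      intro i hi
      obtain ⟨a, ha, hia⟩ := (mem_vars_iff_mem_support i).1 hi
      simpa using hPU a ha hia
    obtain ⟨P', rfl⟩ := exists_rename_eq_of_vars_subset_range P u huinj hv
    have h0 : aeval ((fun i => π (X i)) ∘ u) P' = 0 := by
      rw [← aeval_rename, hx]
      simp [π, Ideal.Quotient.eq_zero_iff_mem.2 hP]
    rw [(injective_iff_map_eq_zero _).1 hind P' h0]
    simp

/-! ### Counting points by the footprint bound. -/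

/-- Every function on a finite set of points is given by a polynomial. -/
theorem exists_eval_eq_on_finset {K : Type*} [Field K] {n : ℕ} (Z : Finset (Fin n → K))
    (f : (Fin n → K) → K) : ∃ P : MvPolynomial (Fin n) K, ∀ x ∈ Z, eval x P = f x := by
  classical
  have hsep : ∀ x y : Fin n → K, ∃ P : MvPolynomial (Fin n) K,
      eval x P = 1 ∧ (x ≠ y → eval y P = 0) := by
    intro x y
    by_cases hxy : x = y
    · exact ⟨1, by simp, fun h => absurd hxy h⟩
    · obtain ⟨i, hi⟩ := Function.ne_iff.1 hxy
      refine ⟨C (x i - y i)⁻¹ * (X i - C (y i)), ?_, fun _ => by simp⟩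
      simp [inv_mul_cancel₀ (sub_ne_zero.2 hi)]
  choose L hL1 hL0 using hsep
  refine ⟨∑ x ∈ Z, C (f x) * ∏ y ∈ Z.erase x, L x y, fun z hz => ?_⟩
  rw [map_sum, Finset.sum_eq_single z]
  · simp [hL1]
  · intro x _ hxz
    have : z ∈ Z.erase x := Finset.mem_erase.2 ⟨hxz.symm, hz⟩
    rw [map_mul, eval_prod, Finset.prod_eq_zero this (hL0 x z hxz), mul_zero]
  · exact fun h => absurd hz h

/-- **Footprint bound**: the number of points of a finite set is at most the number of monomials
which are not divisible by the leading monomial of a polynomial vanishing on it. -/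
theorem card_le_card_of_standard_monomials {K : Type*} [Field K] {n : ℕ} (m : MonomialOrder (Fin n))
    (Z : Finset (Fin n → K)) (Δ : Finset (Fin n →₀ ℕ))
    (hΔ : ∀ c ∉ Δ, ∃ q : MvPolynomial (Fin n) K, q ≠ 0 ∧ (∀ x ∈ Z, eval x q = 0) ∧ m.degree q ≤ c) :
    Z.card ≤ Δ.card := by
  classical
  let ev : MvPolynomial (Fin n) K →ₗ[K] (Z → K) :=
    LinearMap.pi fun x => (aeval (x : Fin n → K)).toLinearMap
  have hev : ∀ P x, ev P x = eval (x : Fin n → K) P := fun P x => by simp [ev, aeval_eq_eval]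
  let W := Δ.image fun c => ev (monomial c 1)
  have hW : Submodule.span K (W : Set (Z → K)) = ⊤ := by
    rw [eq_top_iff]
    rintro f -
    obtain ⟨P, hP⟩ := exists_eval_eq_on_finset Z fun x => if h : x ∈ Z then f ⟨x, h⟩ else 0
    -- Division by all nonzero polynomials vanishing on `Z` at once: the remainder has the same
    -- values on `Z` and involves only monomials from `Δ`.
    obtain ⟨g, r, hPr, -, hr⟩ := m.div_set
      (B := {q : MvPolynomial (Fin n) K | q ≠ 0 ∧ ∀ x ∈ Z, eval x q = 0})
      (fun b hb => isUnit_iff_ne_zero.2 (m.leadingCoeff_ne_zero_iff.2 hb.1)) P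
    have hf : f = ev r := by
      funext x
      rw [hev]
      have h1 := hP x x.2
      simp only [x.2, dite_true] at h1
      rw [← h1, hPr, map_add, Finsupp.linearCombination_apply, Finsupp.sum, map_sum,
        Finset.sum_eq_zero, zero_add]
      intro b _
      simp [b.2.2 x x.2]
    rw [hf, r.as_sum, map_sum]
    refine Submodule.sum_mem _ fun c hc => ?_
    have hcΔ : c ∈ Δ := by
      by_contra h
      obtain ⟨q, hq0, hqZ, hqc⟩ := hΔ c h
      exact hr c hc q ⟨hq0, hqZ⟩ hqc
    have : monomial c (coeff c r) = coeff c r • monomial c (1 : K) := by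
      rw [smul_monomial, smul_eq_mul, mul_one]
    rw [this, map_smul]
    exact Submodule.smul_mem _ _ (Submodule.subset_span (by simpa [W] using ⟨c, hcΔ, rfl⟩))
  calc Z.card = Module.finrank K (Z → K) := by simp
    _ = Module.finrank K (Submodule.span K (W : Set (Z → K))) := by rw [hW, finrank_top]
    _ ≤ W.card := finrank_span_finset_le_card W
    _ ≤ Δ.card := Finset.card_image_le

/-- The number of points with coordinates in `S` at which, for every set `T` of `e + 1`
coordinates, some nonzero polynomial of bounded degree in the coordinates in `T` vanishes. -/
theorem card_le_of_vanishing_coordinate_polynomials {K : Type*} [Field K] {n e m : ℕ} (he : e ≤ n)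
    (S : Finset K) (Z : Finset (Fin n → K)) (hZ : ∀ x ∈ Z, ∀ i, x i ∈ S)
    (hq : ∀ T : Finset (Fin n), T.card = e + 1 → ∃ q : MvPolynomial (Fin n) K, q ≠ 0 ∧
      (∀ a ∈ q.support, a.support ⊆ T ∧ ∀ i, a i ≤ m) ∧ ∀ x ∈ Z, eval x q = 0) :
    Z.card ≤ 2 ^ n * ((m + 1) ^ n * S.card ^ e) := by
  classical
  -- A monomial outside `Δ` has either an exponent at least `S.card`, and is handled by `∏ s ∈ S, (X
  -- i - C s)`, or more than `e` exponents exceeding `m`, and is handled by some `q` from `hq`.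
  let box : Finset (Fin n) → Finset (Fin n → ℕ) := fun T =>
    Fintype.piFinset fun i => if i ∈ T then Finset.range S.card else Finset.range (m + 1)
  let Δ : Finset (Fin n →₀ ℕ) :=
    ((Finset.powersetCard e Finset.univ).biUnion box).image Finsupp.equivFunOnFinite.symm
  have hΔ : Δ.card ≤ 2 ^ n * ((m + 1) ^ n * S.card ^ e) := by
    refine Finset.card_image_le.trans (Finset.card_biUnion_le.trans ?_)
    have hbox : ∀ T ∈ Finset.powersetCard e (Finset.univ : Finset (Fin n)),
        (box T).card ≤ (m + 1) ^ n * S.card ^ e := by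
      intro T hT
      rw [Fintype.card_piFinset]
      calc ∏ i, (if i ∈ T then Finset.range S.card else Finset.range (m + 1)).card
          ≤ ∏ i, ((m + 1) * if i ∈ T then S.card else 1) := by
            refine Finset.prod_le_prod' fun i _ => ?_
            split_ifs
            · simpa using Nat.le_mul_of_pos_left _ (Nat.succ_pos m)
            · simp
        _ = (m + 1) ^ n * S.card ^ e := by
            rw [Finset.prod_mul_distrib, Finset.prod_ite_mem]
            simp [(Finset.mem_powersetCard.1 hT).2]
    refine (Finset.sum_le_card_nsmul _ _ _ hbox).trans ?_
    rw [smul_eq_mul]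
    refine Nat.mul_le_mul_right _ ?_
    simpa using Nat.choose_le_two_pow n e
  refine (card_le_card_of_standard_monomials MonomialOrder.lex Z Δ fun c hc => ?_).trans hΔ
  by_cases hcS : ∃ i, S.card ≤ c i
  · obtain ⟨i, hi⟩ := hcS
    refine ⟨∏ s ∈ S, (X i - C s), ?_, fun x hx => ?_, ?_⟩
    · exact Finset.prod_ne_zero_iff.2 fun s _ => (MonomialOrder.lex.monic_X_sub_C i s).ne_zero
    · rw [eval_prod]
      exact Finset.prod_eq_zero (hZ x hx i) (by simp)
    · rw [MonomialOrder.lex.degree_prod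
        fun s _ => (MonomialOrder.lex.monic_X_sub_C i s).ne_zero]
      simpa [MonomialOrder.degree_X_sub_C] using hi
  · push Not at hcS
    have hbig : e < (Finset.univ.filter fun i => m < c i).card := by
      by_contra! h
      obtain ⟨T, hT, hTc⟩ := Finset.exists_superset_card_eq h (by simpa using he)
      refine hc (Finset.mem_image.2 ⟨c, Finset.mem_biUnion.2 ⟨T, ?_, ?_⟩, ?_⟩)
      · simpa using hTc
      · refine Fintype.mem_piFinset.2 fun i => ?_
        split_ifs with hi
        · simpa using hcS i
        · have : ¬ m < c i := fun h => hi (hT (by simpa using h))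
          simp; omega
      · ext; simp
    obtain ⟨T, hT, hTc⟩ := Finset.exists_subset_card_eq (Nat.succ_le_of_lt hbig)
    obtain ⟨q, hq0, hqs, hqZ⟩ := hq T hTc
    refine ⟨q, hq0, hqZ, fun i => ?_⟩
    obtain ⟨h1, h2⟩ := hqs _ (MonomialOrder.lex.degree_mem_support hq0)
    by_cases hi : i ∈ T
    · have := hT hi
      simp only [Finset.mem_filter] at this
      exact (h2 i).trans this.2.le
    · have : MonomialOrder.lex.degree q i = 0 := by
        by_contra h; exact hi (h1 (by simpa using h))
      omega

/-! ### Linear dependence by counting, and an effective Nullstellensatz. -/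

/-- A family with more members than a spanning set of a space containing it satisfies a
nontrivial linear relation. -/
theorem exists_sum_smul_eq_zero_of_card_lt {K V ι : Type*} [Field K] [AddCommGroup V] [Module K V]
    [Fintype ι] (v : ι → V) (W : Finset V) (hv : ∀ i, v i ∈ Submodule.span K (W : Set V))
    (hW : W.card < Fintype.card ι) : ∃ c : ι → K, ∑ i, c i • v i = 0 ∧ ∃ i, c i ≠ 0 := by
  refine Fintype.not_linearIndependent_iff.1 fun hind => ?_
  have h1 : LinearIndependent K fun i => (⟨v i, hv i⟩ : Submodule.span K (W : Set V)) :=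
    LinearIndependent.of_comp (Submodule.subtype _) hind
  have := h1.fintype_card_le_finrank
  exact absurd (this.trans (finrank_span_finset_le_card W)) (not_le.2 hW)

theorem MvPolynomial.IsHomogeneous.degree_eq_of_mem_support {σ K : Type*} [CommSemiring K] {D : ℕ}
    {P : MvPolynomial σ K} (hP : P.IsHomogeneous D) {c : σ →₀ ℕ} (hc : c ∈ P.support) :
    c.degree = D := by
  rw [Finsupp.degree_eq_weight_one]
  exact hP (mem_support_iff.1 hc)

theorem homogeneousComponent_add_mul {σ K : Type*} [CommRing K] {e : ℕ}
    {f : MvPolynomial σ K} (hf : f.IsHomogeneous e) (v : MvPolynomial σ K) (k : ℕ) :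
    homogeneousComponent (k + e) (v * f) = homogeneousComponent k v * f := by
  have key : ∀ j, homogeneousComponent (k + e) (homogeneousComponent j v * f) =
      if k = j then homogeneousComponent j v * f else 0 := by
    intro j
    rw [homogeneousComponent_of_mem (n := j + e)
      ((mem_homogeneousSubmodule _ _).2 ((homogeneousComponent_isHomogeneous j v).mul hf))]
    simp
  conv_lhs => rw [← sum_homogeneousComponent v, Finset.sum_mul, map_sum]
  simp_rw [key]
  rw [Finset.sum_ite_eq]
  split_ifs with h
  · rfl
  · rw [homogeneousComponent_eq_zero k v (by simpa using h), zero_mul]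

/-- A form in an ideal generated by forms of degree `e` is a combination of these with forms as
coefficients. -/
theorem MvPolynomial.IsHomogeneous.exists_sum_mul_eq_of_mem_span {σ τ K : Type*} [CommRing K] [Fintype τ] {e k : ℕ}
    {f : τ → MvPolynomial σ K} (hf : ∀ j, (f j).IsHomogeneous e) {P : MvPolynomial σ K}
    (hP : P.IsHomogeneous (k + e)) (hmem : P ∈ Ideal.span (Set.range f)) :
    ∃ u : τ → MvPolynomial σ K, (∀ j, (u j).IsHomogeneous k) ∧ ∑ j, u j * f j = P := by
  obtain ⟨v, hv⟩ := Ideal.mem_span_range_iff_exists_fun.1 hmem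
  refine ⟨fun j => homogeneousComponent k (v j),
    fun j => homogeneousComponent_isHomogeneous k _, ?_⟩
  rw [← homogeneousComponent_eq_self hP, ← hv, map_sum]
  exact Finset.sum_congr rfl fun j _ => (homogeneousComponent_add_mul (hf j) _ _).symm

/-- Hilbert's Nullstellensatz, with no control of `M`. It serves only to give integrality and
nilpotency; the exponent is bounded later, in `pow_mem_span_of_forall_eq_zero`. -/
theorem exists_pow_mem_span_of_forall_eq_zero {σ τ K : Type*} [Field K] [IsAlgClosed K] [Finite σ]
    (f : τ → MvPolynomial σ K) (hf : ∀ x : σ → K, (∀ j, eval x (f j) = 0) → x = 0) :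
    ∃ M, ∀ i, (X i : MvPolynomial σ K) ^ M ∈ Ideal.span (Set.range f) := by
  have := Fintype.ofFinite σ
  have h : ∀ i, ∃ m, (X i : MvPolynomial σ K) ^ m ∈ Ideal.span (Set.range f) := by
    intro i
    have : (X i : MvPolynomial σ K) ∈ (Ideal.span (Set.range f)).radical := by
      rw [← vanishingIdeal_zeroLocus_eq_radical (K := K)]
      intro x hx
      have : x = 0 := hf x fun j => by
        simpa [aeval_eq_eval] using hx (f j) (Ideal.subset_span ⟨j, rfl⟩)
      simp [this]
    exact this
  choose m hm using h
  exact ⟨∑ i, m i, fun i => Ideal.pow_mem_of_pow_mem _ (hm i)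
    (Finset.single_le_sum (fun _ _ => Nat.zero_le _) (Finset.mem_univ i))⟩

/-- If powers of all variables lie in an ideal generated by finitely many forms of positive degree,
the polynomial ring is integral over the subalgebra generated by the forms. -/
theorem isIntegral_aeval_of_pow_mem_span {σ τ K : Type*} [Field K] [Finite σ] [Fintype τ] {e M : ℕ}
    (he : 0 < e) (f : τ → MvPolynomial σ K) (hf : ∀ j, (f j).IsHomogeneous e)
    (hM : ∀ i, (X i : MvPolynomial σ K) ^ M ∈ Ideal.span (Set.range f)) :
    (aeval f : MvPolynomial τ K →ₐ[K] MvPolynomial σ K).toRingHom.IsIntegral := by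
  classical
  have := Fintype.ofFinite σ
  algebraize [(aeval f : MvPolynomial τ K →ₐ[K] MvPolynomial σ K).toRingHom]
  have hmap : ∀ P : MvPolynomial τ K, algebraMap _ (MvPolynomial σ K) P = aeval f P := fun P => rfl
  have hM' : ∀ i, ∃ u : τ → MvPolynomial σ K, (∀ j, (u j).IsHomogeneous M) ∧
      ∑ j, u j * f j = (X i : MvPolynomial σ K) ^ (M + e) := fun i =>
    IsHomogeneous.exists_sum_mul_eq_of_mem_span hf (isHomogeneous_X_pow i _)
      (Ideal.pow_mem_of_pow_mem _ (hM i) (Nat.le_add_right _ _))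
  let Δ : Finset (σ → ℕ) := Fintype.piFinset fun _ => Finset.range (M + e)
  let W : Set (MvPolynomial σ K) :=
    (fun a => monomial (Finsupp.equivFunOnFinite.symm a) (1 : K)) '' Δ
  have hhom : ∀ D, ∀ P : MvPolynomial σ K, P.IsHomogeneous D →
      P ∈ Submodule.span (MvPolynomial τ K) W := by
    intro D
    induction D using Nat.strong_induction_on with
    | _ D ih =>
      intro P hP
      rw [P.as_sum]
      refine Submodule.sum_mem _ fun c hc => ?_
      have hcD : c.degree = D := hP.degree_eq_of_mem_support hc
      have hscal : monomial c (coeff c P) =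
          (C (coeff c P) : MvPolynomial τ K) • (monomial c 1 : MvPolynomial σ K) := by
        rw [Algebra.smul_def, hmap, aeval_C, ← Algebra.smul_def, smul_monomial]; simp
      rw [hscal]
      refine Submodule.smul_mem _ _ ?_
      by_cases h : ∀ i, c i < M + e
      · refine Submodule.subset_span ⟨c, ?_, by simp⟩
        simpa [Δ] using h
      · push Not at h
        obtain ⟨i, hi⟩ := h
        obtain ⟨u, hu, hsum⟩ := hM' i
        have hsub : Finsupp.single i (M + e) ≤ c := Finsupp.single_le_iff.2 hi
        -- A factor `X i ^ (M + e)` is traded for `∑ j, u j * f j`. The `f j` act as scalars, and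
        -- since `0 < e` the remaining forms have smaller degree.
        have hc' : (monomial c 1 : MvPolynomial σ K) =
            ∑ j, (X j : MvPolynomial τ K) • (monomial (c - Finsupp.single i (M + e)) 1 * u j) := by
          have : (monomial c 1 : MvPolynomial σ K) =
              monomial (c - Finsupp.single i (M + e)) 1 * X i ^ (M + e) := by
            rw [X_pow_eq_monomial, monomial_mul, tsub_add_cancel_of_le hsub, one_mul]
          rw [this, ← hsum, Finset.mul_sum]
          refine Finset.sum_congr rfl fun j _ => ?_
          rw [Algebra.smul_def, hmap, aeval_X]; ring
        rw [hc']
        refine Submodule.sum_mem _ fun j _ => Submodule.smul_mem _ _ ?_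
        have hdeg : (c - Finsupp.single i (M + e)).degree + (M + e) = D := by
          rw [← hcD]
          conv_rhs => rw [← tsub_add_cancel_of_le hsub]
          simp
        refine ih ((c - Finsupp.single i (M + e)).degree + M) (by omega) _ ?_
        exact (isHomogeneous_monomial _ rfl).mul (hu j)
  have hfin : Module.Finite (MvPolynomial τ K) (MvPolynomial σ K) := by
    refine Module.finite_def.2 (Submodule.fg_def.2 ⟨W, (Finset.finite_toSet Δ).image _, ?_⟩)
    rw [eq_top_iff]
    rintro P -
    rw [← sum_homogeneousComponent P]
    exact Submodule.sum_mem _ fun k _ => hhom k _ (homogeneousComponent_isHomogeneous k P)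
  exact Algebra.IsIntegral.isIntegral

/-- `n` elements over which the polynomial ring in `n` variables is integral are algebraically
independent. -/
theorem algebraicIndependent_of_isIntegral {σ τ K : Type*} [Field K] [Fintype σ] [Fintype τ]
    (hστ : Fintype.card τ = Fintype.card σ) (f : τ → MvPolynomial σ K)
    (hint : (aeval f : MvPolynomial τ K →ₐ[K] MvPolynomial σ K).toRingHom.IsIntegral) :
    AlgebraicIndependent K f := by
  have halg : Algebra.IsAlgebraic (Algebra.adjoin K (Set.range f)) (MvPolynomial σ K) := by
    constructor
    intro a
    obtain ⟨p, hp, hpa⟩ := hint a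
    let ψ : MvPolynomial τ K →+* Algebra.adjoin K (Set.range f) :=
      ((aeval f).codRestrict (Algebra.adjoin K (Set.range f)) fun P => by
        rw [Algebra.adjoin_range_eq_range_aeval]; exact ⟨P, rfl⟩).toRingHom
    have hi : IsIntegral (Algebra.adjoin K (Set.range f)) a := by
      refine ⟨p.map ψ, hp.map ψ, ?_⟩
      rw [Polynomial.eval₂_map]
      exact hpa
    exact hi.isAlgebraic
  refine (Algebra.IsAlgebraic.isTranscendenceBasis_of_lift_le_trdeg_of_finite K f ?_).1
  rw [MvPolynomial.trdeg_of_isDomain]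
  simp [hστ]

/-- If the powers of `x` up to `r`, multiplied by monomials in forms `f j`, outnumber the monomials
of the corresponding degrees, then `x` satisfies a nontrivial polynomial of degree less than `r`
over the polynomials in the `f j`. -/
theorem exists_polynomial_relation {σ τ K : Type*} [Field K] [Fintype σ] [Fintype τ] {e : ℕ}
    (hστ : Fintype.card τ = Fintype.card σ) (f : τ → MvPolynomial σ K)
    (hf : ∀ j, (f j).IsHomogeneous e) (i : σ) :
    ∃ p : Polynomial (MvPolynomial τ K), p ≠ 0 ∧ p.natDegree ≤ (Fintype.card σ * e + 1) ^ Fintype.card σ ∧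
      p.eval₂ (aeval f : MvPolynomial τ K →ₐ[K] MvPolynomial σ K).toRingHom (X i) = 0 := by
  classical
  set n := Fintype.card σ with hn
  -- There are `r * (r + 1) ^ n` products in `v`, against at most `((n * e + 1) * (r + 1)) ^ n`
  -- monomials in `W`; the products win as soon as `r > (n * e + 1) ^ n`.
  set r := (n * e + 1) ^ n + 1 with hr
  let ι := Fin r × (τ → Fin (r + 1))
  let v : ι → MvPolynomial σ K := fun a => X i ^ (a.1 : ℕ) * ∏ j, f j ^ (a.2 j : ℕ)
  let Δ : Finset (σ → ℕ) := Fintype.piFinset fun _ => Finset.range (r + n * (e * r) + 1)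
  let W : Finset (MvPolynomial σ K) :=
    Δ.image fun a => monomial (Finsupp.equivFunOnFinite.symm a) (1 : K)
  have hv : ∀ a, v a ∈ Submodule.span K (W : Set (MvPolynomial σ K)) := by
    intro a
    have hhom : (v a).IsHomogeneous (a.1 + ∑ j, e * (a.2 j : ℕ)) :=
      (isHomogeneous_X_pow i _).mul (IsHomogeneous.prod _ _ _ fun j _ => (hf j).pow _)
    have hdeg : (a.1 : ℕ) + ∑ j, e * (a.2 j : ℕ) ≤ r + n * (e * r) := by
      refine Nat.add_le_add a.1.2.le ?_
      calc ∑ j, e * (a.2 j : ℕ) ≤ ∑ _j : τ, e * r :=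
            Finset.sum_le_sum fun j _ => Nat.mul_le_mul_left _ (Nat.lt_succ_iff.1 (a.2 j).2)
        _ = n * (e * r) := by simp [hστ]
    rw [(v a).as_sum]
    refine Submodule.sum_mem _ fun c hc => ?_
    have hcD : c.degree = a.1 + ∑ j, e * (a.2 j : ℕ) := hhom.degree_eq_of_mem_support hc
    have : monomial c (coeff c (v a)) = coeff c (v a) • monomial c (1 : K) := by
      rw [smul_monomial, smul_eq_mul, mul_one]
    rw [this]
    refine Submodule.smul_mem _ _ (Submodule.subset_span ?_)
    refine Finset.mem_coe.2 (Finset.mem_image.2 ⟨c, Fintype.mem_piFinset.2 fun k => ?_, by simp⟩)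
    have := Finsupp.le_degree k c
    rw [Finset.mem_range]; omega
  have hcard : W.card < Fintype.card ι := by
    refine Finset.card_image_le.trans_lt ?_
    have h1 : Fintype.card ι = r * (r + 1) ^ n := by simp [ι, hστ]
    have h2 : Δ.card = (r + n * (e * r) + 1) ^ n := by simp [Δ, hn]
    rw [h1, h2]
    calc (r + n * (e * r) + 1) ^ n ≤ ((n * e + 1) * (r + 1)) ^ n :=
          Nat.pow_le_pow_left (by nlinarith [Nat.zero_le (n * e)]) _
      _ = (n * e + 1) ^ n * (r + 1) ^ n := mul_pow _ _ _
      _ < r * (r + 1) ^ n := Nat.mul_lt_mul_of_pos_right (Nat.lt_succ_self _) (by positivity)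
  obtain ⟨c, hc0, ⟨a₀, ha₀⟩⟩ := exists_sum_smul_eq_zero_of_card_lt v W hv hcard
  let q : Fin r → MvPolynomial τ K := fun k =>
    ∑ b : τ → Fin (r + 1), monomial (Finsupp.equivFunOnFinite.symm fun j => (b j : ℕ)) (c (k, b))
  let p : Polynomial (MvPolynomial τ K) := ∑ k : Fin r, Polynomial.monomial (k : ℕ) (q k)
  have hpcoeff : ∀ k : Fin r, p.coeff k = q k := by
    intro k
    simp only [p, Polynomial.finsetSum_coeff, Polynomial.coeff_monomial]
    rw [Finset.sum_eq_single k] <;> simp +contextual [Fin.ext_iff]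
  have hqcoeff : ∀ k b, coeff (Finsupp.equivFunOnFinite.symm fun j => ((b : τ → Fin (r + 1)) j : ℕ))
      (q k) = c (k, b) := by
    intro k b
    simp only [q, coeff_sum, coeff_monomial]
    rw [Finset.sum_eq_single b]
    · simp
    · intro b' _ hb'
      rw [if_neg]
      intro h
      refine hb' (funext fun j => Fin.ext ?_)
      simpa using DFunLike.congr_fun h j
    · simp
  refine ⟨p, fun hp => ha₀ ?_, ?_, ?_⟩
  · rw [← hqcoeff a₀.1 a₀.2, ← hpcoeff, hp]; simp
  · refine Polynomial.natDegree_sum_le_of_forall_le _ _ fun k _ => ?_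
    exact (Polynomial.natDegree_monomial_le _).trans (Nat.lt_succ_iff.1 k.2)
  · rw [← hc0, Fintype.sum_prod_type]
    simp only [p, Polynomial.eval₂_finsetSum, Polynomial.eval₂_monomial]
    refine Finset.sum_congr rfl fun k _ => ?_
    simp only [q, AlgHom.toRingHom_eq_coe, RingHom.coe_coe, map_sum, Finset.sum_mul, v]
    refine Finset.sum_congr rfl fun b _ => ?_
    rw [aeval_monomial, Finsupp.prod_fintype _ _ (by simp), Algebra.smul_def]
    simp only [Finsupp.equivFunOnFinite_symm_apply_apply]
    ring

/-- A nilpotent root of a monic polynomial of degree at most `N` has vanishing `N`-th power. -/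
theorem pow_eq_zero_of_nilpotent_of_monic {K A : Type*} [Field K] [CommRing A] [Algebra K A]
    {x : A} (hx : IsNilpotent x) {μ : Polynomial K} (hμ : μ.Monic) {N : ℕ} (hN : μ.natDegree ≤ N)
    (h : Polynomial.aeval x μ = 0) : x ^ N = 0 := by
  obtain ⟨M, hM⟩ := hx
  -- The minimal polynomial over `K` divides a power of `X`, so it is `X ^ k` up to a unit; as it
  -- also divides `μ`, `k ≤ N`.
  obtain ⟨k, -, hk⟩ := (dvd_prime_pow Polynomial.prime_X M).1
    (minpoly.dvd K x (p := Polynomial.X ^ M) (by simpa using hM))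
  have hkx : x ^ k = 0 := by
    obtain ⟨u, hu⟩ := hk
    have := congrArg (Polynomial.aeval x) hu
    simpa using this.symm
  have hkN : k ≤ N := by
    have h1 := Polynomial.natDegree_le_of_dvd (minpoly.dvd K x h) hμ.ne_zero
    have h2 := Polynomial.natDegree_eq_of_degree_eq (Polynomial.degree_eq_degree_of_associated hk)
    rw [Polynomial.natDegree_X_pow] at h2
    omega
  exact pow_eq_zero_of_le hkN hkx

/-- An effective Nullstellensatz: if `n` forms of degree `e` in `n` variables have only the trivial
common zero, then the ideal they generate contains a power of each variable whose exponent is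
bounded in terms of `n` and `e`. -/
theorem pow_mem_span_of_forall_eq_zero {σ τ K : Type*} [Field K] [IsAlgClosed K] [Fintype σ]
    [Fintype τ] {e : ℕ} (he : 0 < e) (hστ : Fintype.card τ = Fintype.card σ)
    (f : τ → MvPolynomial σ K) (hf : ∀ j, (f j).IsHomogeneous e)
    (h0 : ∀ x : σ → K, (∀ j, eval x (f j) = 0) → x = 0) (i : σ) :
    (X i : MvPolynomial σ K) ^ ((Fintype.card σ * e + 1) ^ Fintype.card σ) ∈
      Ideal.span (Set.range f) := by
  obtain ⟨M, hM⟩ := exists_pow_mem_span_of_forall_eq_zero f h0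
  have hint := isIntegral_aeval_of_pow_mem_span he f hf hM
  have hind := algebraicIndependent_of_isIntegral hστ f hint
  obtain ⟨p, hp0, hpdeg, hp⟩ := exists_polynomial_relation hστ f hf i
  set I := Ideal.span (Set.range f)
  algebraize [(aeval f : MvPolynomial τ K →ₐ[K] MvPolynomial σ K).toRingHom]
  have hX : IsIntegral (MvPolynomial τ K) (X i : MvPolynomial σ K) := hint _
  have : Module.IsTorsionFree (MvPolynomial τ K) (MvPolynomial σ K) :=
    (faithfulSMul_iff_algebraMap_injective _ _).2 hind |>.to_isTorsionFree
  -- The relation `p` has bounded degree but need not be monic. Over an integrally closed ring the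
  -- monic minimal polynomial divides it and so inherits the degree bound.
  have hdvd := minpoly.isIntegrallyClosed_dvd hX (p := p) hp
  set μ := minpoly (MvPolynomial τ K) (X i : MvPolynomial σ K) with hμ
  have hμmonic : μ.Monic := minpoly.monic hX
  -- Modulo `I` the `f j` vanish, so coefficients of `μ` reduce to their constant terms and `X i`
  -- becomes a nilpotent root of a monic polynomial over `K`.
  have hcomp : (Ideal.Quotient.mk I).comp (aeval f : MvPolynomial τ K →ₐ[K] MvPolynomial σ K).toRingHom =
      (algebraMap K (MvPolynomial σ K ⧸ I)).comp constantCoeff := by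
    refine MvPolynomial.ringHom_ext (fun a => ?_) fun j => ?_
    · simp [algebraMap_eq]; rfl
    · have : f j ∈ I := Ideal.subset_span ⟨j, rfl⟩
      simpa using Ideal.Quotient.eq_zero_iff_mem.2 this
  have hroot : Polynomial.aeval (Ideal.Quotient.mk I (X i)) (μ.map constantCoeff) = 0 := by
    rw [Polynomial.aeval_def, Polynomial.eval₂_map, ← hcomp, ← Polynomial.hom_eval₂]
    have : Polynomial.eval₂ (aeval f : MvPolynomial τ K →ₐ[K] MvPolynomial σ K).toRingHom (X i) μ = 0 :=
      minpoly.aeval (MvPolynomial τ K) (X i : MvPolynomial σ K)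
    rw [this, map_zero]
  have hnil : IsNilpotent (Ideal.Quotient.mk I (X i)) :=
    ⟨M, by rw [← map_pow]; exact Ideal.Quotient.eq_zero_iff_mem.2 (hM i)⟩
  have hdeg : (μ.map constantCoeff).natDegree ≤ (Fintype.card σ * e + 1) ^ Fintype.card σ :=
    Polynomial.natDegree_map_le.trans
      ((Polynomial.natDegree_le_of_dvd hdvd hp0).trans hpdeg)
  have := pow_eq_zero_of_nilpotent_of_monic hnil (hμmonic.map constantCoeff) hdeg hroot
  rw [← map_pow] at this
  exact Ideal.Quotient.eq_zero_iff_mem.1 this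

/-! ### The Hessian equations and the relations they impose. -/

/-- The products of monomials in `x` with exponents less than `N` and monomials in `l` with
exponents at most `t`. -/
noncomputable def boundedProducts {σ B : Type*} [Fintype σ] [CommRing B] (N t : ℕ) (x l : σ → B) :
    Finset B := by
  classical
  exact ((Fintype.piFinset fun _ : σ => Finset.range N) ×ˢ
    (Fintype.piFinset fun _ : σ => Finset.range (t + 1))).image
      fun ab => (∏ i, x i ^ ab.1 i) * ∏ i, l i ^ ab.2 i

theorem card_boundedProducts_le {σ B : Type*} [Fintype σ] [CommRing B] (N t : ℕ) (x l : σ → B) :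
    (boundedProducts N t x l).card ≤ N ^ Fintype.card σ * (t + 1) ^ Fintype.card σ := by
  classical
  refine Finset.card_image_le.trans ?_
  simp [Finset.card_product]

theorem prod_mul_prod_mem_boundedProducts {σ B : Type*} [Fintype σ] [CommRing B] {N t : ℕ}
    {x l : σ → B} {a b : σ → ℕ} (ha : ∀ i, a i < N) (hb : ∀ i, b i ≤ t) :
    (∏ i, x i ^ a i) * ∏ i, l i ^ b i ∈ boundedProducts N t x l := by
  classical
  refine Finset.mem_image.2 ⟨(a, b), Finset.mem_product.2 ⟨?_, ?_⟩, rfl⟩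
  · simpa using ha
  · simpa [Nat.lt_succ_iff] using hb

section

variable {σ K B : Type*} [Fintype σ] [Field K] [CommRing B] [Algebra K B] {e k : ℕ}
  {F : MvPolynomial σ K}

/-- Along solutions of `Hess F(x) h = 0`, polynomials in `x` and `x - h` reduce to bounded degree
in `x`. -/
theorem aeval_mul_aeval_sub_mem_span (hF : F.IsHomogeneous (e + 1)) (he : (e : K) ≠ 0)
    (hk : ∀ i, (X i : MvPolynomial σ K) ^ (k + e) ∈ Ideal.span (Set.range fun j => pderiv j F))
    {x h : σ → B} (hxh : ∀ i, ∑ j, h j * aeval x (pderiv j (pderiv i F)) = 0) (t : ℕ) :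
    ∀ D D' : ℕ, ∀ P Q : MvPolynomial σ K, P.IsHomogeneous D → Q.IsHomogeneous D' → D + D' ≤ t →
      aeval x P * aeval (x - h) Q ∈
        Submodule.span K (boundedProducts (k + e) t x (x - h) : Set B) := by
  intro D
  induction D using Nat.strong_induction_on with
  | _ D ih =>
  intro D' P Q hP hQ hD
  have hpF : ∀ i, (pderiv i F).IsHomogeneous e := fun i => hF.pderiv
  rw [P.as_sum, map_sum, Finset.sum_mul]
  refine Submodule.sum_mem _ fun c hc => ?_
  have hcD : c.degree = D := hP.degree_eq_of_mem_support hc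
  have hc1 : monomial c (coeff c P) = coeff c P • monomial c (1 : K) := by
    rw [smul_monomial, smul_eq_mul, mul_one]
  rw [hc1, map_smul, smul_mul_assoc]
  refine Submodule.smul_mem _ _ ?_
  by_cases hck : ∀ i, c i < k + e
  · rw [Q.as_sum, map_sum, Finset.mul_sum]
    refine Submodule.sum_mem _ fun b hb => ?_
    have hbD : b.degree = D' := hQ.degree_eq_of_mem_support hb
    have hb1 : monomial b (coeff b Q) = coeff b Q • monomial b (1 : K) := by
      rw [smul_monomial, smul_eq_mul, mul_one]
    rw [hb1, map_smul, mul_smul_comm]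
    refine Submodule.smul_mem _ _ (Submodule.subset_span ?_)
    rw [aeval_monomial, aeval_monomial, map_one, one_mul, one_mul,
      Finsupp.prod_fintype _ _ (by simp), Finsupp.prod_fintype _ _ (by simp)]
    refine prod_mul_prod_mem_boundedProducts hck fun i => ?_
    have := Finsupp.le_degree i b
    omega
  · push Not at hck
    obtain ⟨i, hi⟩ := hck
    obtain ⟨u, hu, hsum⟩ := IsHomogeneous.exists_sum_mul_eq_of_mem_span hpF
      (isHomogeneous_X_pow i _) (hk i)
    have hsub : Finsupp.single i (k + e) ≤ c := Finsupp.single_le_iff.2 hi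
    set c' := c - Finsupp.single i (k + e)
    have hdeg : c'.degree + (k + e) = D := by
      rw [← hcD, ← tsub_add_cancel_of_le hsub]
      simp [c']
    have he0 : 0 < e := Nat.pos_of_ne_zero fun h0 => he (by simp [h0])
    have hc2 : (monomial c 1 : MvPolynomial σ K) = monomial c' 1 * ∑ j, u j * pderiv j F := by
      rw [hsum, X_pow_eq_monomial, monomial_mul, tsub_add_cancel_of_le hsub, one_mul]
    -- Euler's formula for `pderiv j F`, with `x` replaced by `x - h`, which is allowed because the
    -- Hessian kills `h`. This moves one degree from `P` to `Q` and keeps `D + D'` fixed, so the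
    -- induction on `D` proceeds.
    have heuler : ∀ j, aeval x (pderiv j F) =
        (e : K)⁻¹ • ∑ i, (x i - h i) * aeval x (pderiv i (pderiv j F)) := by
      intro j
      rw [eq_inv_smul_iff₀ he]
      have := congrArg (aeval x) (hpF j).sum_X_mul_pderiv
      simp only [map_sum, map_mul, aeval_X, map_nsmul] at this
      simp_rw [sub_mul, Finset.sum_sub_distrib, hxh, this]
      rw [Nat.cast_smul_eq_nsmul, sub_zero]
    have key : aeval x (monomial c 1 : MvPolynomial σ K) * aeval (x - h) Q =
        ∑ j, ∑ i, (e : K)⁻¹ • (aeval x (monomial c' 1 * (u j * pderiv i (pderiv j F))) *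
          aeval (x - h) (Q * X i)) := by
      rw [hc2]
      simp only [map_mul, map_sum, heuler, aeval_X, Finset.smul_sum, Finset.mul_sum,
        Finset.sum_mul, Pi.sub_apply]
      refine Finset.sum_congr rfl fun j _ => Finset.sum_congr rfl fun i _ => ?_
      simp only [Algebra.smul_def]
      ring
    rw [key]
    refine Submodule.sum_mem _ fun j _ => Submodule.sum_mem _ fun i _ => Submodule.smul_mem _ _ ?_
    refine ih (c'.degree + (k + (e - 1))) (by omega) (D' + 1) _ _ ?_ (hQ.mul (isHomogeneous_X K i))
      (by omega)
    exact (isHomogeneous_monomial _ rfl).mul ((hu j).mul (hpF j).pderiv)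

/-- Each factor `h j` is written as `x j - (x - h) j`. Removing these factors one at a time reduces
to `aeval_mul_aeval_sub_mem_span`, without raising the total degree. -/
theorem aeval_mul_aeval_monomial_mem_span (hF : F.IsHomogeneous (e + 1)) (he : (e : K) ≠ 0)
    (hk : ∀ i, (X i : MvPolynomial σ K) ^ (k + e) ∈ Ideal.span (Set.range fun j => pderiv j F))
    {x h : σ → B} (hxh : ∀ i, ∑ j, h j * aeval x (pderiv j (pderiv i F)) = 0) {t : ℕ}
    (a b : σ →₀ ℕ) (hab : a.degree + b.degree ≤ t) :
    aeval x (monomial a 1 : MvPolynomial σ K) * aeval h (monomial b 1 : MvPolynomial σ K) ∈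
      Submodule.span K (boundedProducts (k + e) t x (x - h) : Set B) := by
  suffices H : ∀ s, ∀ b : σ →₀ ℕ, b.degree = s → ∀ D D' : ℕ, ∀ P Q : MvPolynomial σ K,
      P.IsHomogeneous D → Q.IsHomogeneous D' → D + D' + s ≤ t →
      aeval x P * aeval (x - h) Q * aeval h (monomial b 1 : MvPolynomial σ K) ∈
        Submodule.span K (boundedProducts (k + e) t x (x - h) : Set B) by
    simpa using H _ b rfl _ 0 _ 1 (isHomogeneous_monomial 1 (rfl : a.degree = _))
      (isHomogeneous_one σ K) (by omega)
  intro s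
  induction s with
  | zero =>
    intro b hb D D' P Q hP hQ hD
    obtain rfl : b = 0 := (Finsupp.degree_eq_zero_iff b).1 hb
    simpa using aeval_mul_aeval_sub_mem_span hF he hk hxh t D D' P Q hP hQ hD
  | succ s ih =>
    intro b hb D D' P Q hP hQ hD
    obtain ⟨j, hj⟩ : ∃ j, b j ≠ 0 := by
      by_contra! h0
      have : b = 0 := Finsupp.ext h0
      simp [this] at hb
    have hsub : Finsupp.single j 1 ≤ b := Finsupp.single_le_iff.2 (Nat.one_le_iff_ne_zero.2 hj)
    obtain ⟨b', rfl⟩ := exists_add_of_le hsub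
    have hb' : b'.degree = s := by simp at hb; omega
    have h1 := ih b' hb' (D + 1) D' (P * X j) Q (hP.mul (isHomogeneous_X K j)) hQ (by omega)
    have h2 := ih b' hb' D (D' + 1) P (Q * X j) hP (hQ.mul (isHomogeneous_X K j)) (by omega)
    have hmon : (monomial (Finsupp.single j 1 + b') 1 : MvPolynomial σ K) = X j * monomial b' 1 := by
      rw [X, monomial_mul, one_mul]
    have := Submodule.sub_mem _ h1 h2
    convert this using 1
    rw [hmon]
    simp only [map_mul, aeval_X, Pi.sub_apply]
    ring

end

/-- The exponents supported on `U` and bounded by `m`. -/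
noncomputable def boxExponents {σ : Type*} (U : Finset σ) (m : ℕ) : Finset (σ →₀ ℕ) := by
  classical
  exact Finset.Iic (Finsupp.indicator U fun _ _ => m)

theorem support_subset_of_mem_boxExponents {σ : Type*} {U : Finset σ} {m : ℕ} {a : σ →₀ ℕ}
    (ha : a ∈ boxExponents U m) : a.support ⊆ U := by
  classical
  intro i hi
  by_contra h
  have := Finset.mem_Iic.1 ha i
  rw [Finsupp.indicator_of_notMem h] at this
  exact (Finsupp.mem_support_iff.1 hi) (Nat.le_zero.1 this)

theorem apply_le_of_mem_boxExponents {σ : Type*} {U : Finset σ} {m : ℕ} {a : σ →₀ ℕ}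
    (ha : a ∈ boxExponents U m) (i : σ) : a i ≤ m := by
  classical
  refine (Finset.mem_Iic.1 ha i).trans ?_
  rw [Finsupp.indicator_apply]
  split_ifs <;> simp

theorem degree_le_of_mem_boxExponents {σ : Type*} {U : Finset σ} {m : ℕ} {a : σ →₀ ℕ}
    (ha : a ∈ boxExponents U m) : a.degree ≤ U.card * m := by
  rw [Finsupp.degree_apply, ← smul_eq_mul]
  refine (Finset.sum_le_card_nsmul _ _ m fun i _ => apply_le_of_mem_boxExponents ha i).trans ?_
  exact Nat.mul_le_mul_right _ (Finset.card_le_card (support_subset_of_mem_boxExponents ha))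

theorem card_boxExponents {σ : Type*} [Fintype σ] (U : Finset σ) (m : ℕ) :
    (boxExponents U m).card = (m + 1) ^ U.card := by
  classical
  rw [boxExponents, Finsupp.card_Iic, ← Finset.prod_const]
  refine (Finset.prod_subset (Finsupp.support_indicator_subset _ _) fun i hi h0 => ?_).trans
    (Finset.prod_congr rfl fun i hi => ?_)
  · simp [Finsupp.notMem_support_iff.1 h0]
  · simp [Finsupp.indicator_of_mem hi]

/-- The Hessian equations `Hess F(x) h = 0` imply a relation of bounded degree between any
`card σ + 1` of the coordinates of `x` and `h`. -/
theorem exists_relation_of_hessian {σ K : Type*} [Fintype σ] [Field K] {e k m : ℕ}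
    {F : MvPolynomial σ K} (hF : F.IsHomogeneous (e + 1)) (he : (e : K) ≠ 0)
    (hk : ∀ i, (X i : MvPolynomial σ K) ^ (k + e) ∈ Ideal.span (Set.range fun j => pderiv j F))
    (hm : ((Fintype.card σ + 1) * (k + e)) ^ Fintype.card σ ≤ m)
    (U T : Finset σ) (hUT : U.card + T.card = Fintype.card σ + 1) :
    ∃ c : (boxExponents U m) × (boxExponents T m) → K, (∃ ab, c ab ≠ 0) ∧
      ∀ x h : σ → K, (∀ i, ∑ j, h j * eval x (pderiv j (pderiv i F)) = 0) →
        ∑ ab, c ab * (eval x (monomial (ab.1 : σ →₀ ℕ) 1) * eval h (monomial (ab.2 : σ →₀ ℕ) 1)) = 0 := by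
  -- Working in the ring of functions on the set of all solutions gives a single relation, with
  -- coefficients independent of `(x, h)`.
  let V := {xh : (σ → K) × (σ → K) //
    ∀ i, ∑ j, xh.2 j * eval xh.1 (pderiv j (pderiv i F)) = 0}
  let x : σ → V → K := fun i v => v.1.1 i
  let h : σ → V → K := fun i v => v.1.2 i
  have hx : ∀ (P : MvPolynomial σ K) (v : V), aeval x P v = eval v.1.1 P := by
    intro P v
    have : (Pi.evalAlgHom K (fun _ : V => K) v).comp (aeval x) = aeval v.1.1 := by
      ext i; simp [x]
    simpa [aeval_eq_eval] using DFunLike.congr_fun this P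
  have hh : ∀ (P : MvPolynomial σ K) (v : V), aeval h P v = eval v.1.2 P := by
    intro P v
    have : (Pi.evalAlgHom K (fun _ : V => K) v).comp (aeval h) = aeval v.1.2 := by
      ext i; simp [h]
    simpa [aeval_eq_eval] using DFunLike.congr_fun this P
  have hxh : ∀ i, ∑ j, h j * aeval x (pderiv j (pderiv i F)) = 0 := by
    intro i
    funext v
    simpa [hx, h] using v.2 i
  set n := Fintype.card σ
  obtain ⟨c, hc0, hc⟩ := exists_sum_smul_eq_zero_of_card_lt
    (fun ab : (boxExponents U m) × (boxExponents T m) =>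
      aeval x (monomial (ab.1 : σ →₀ ℕ) (1 : K)) * aeval h (monomial (ab.2 : σ →₀ ℕ) (1 : K)))
    (boundedProducts (k + e) ((n + 1) * m) x (x - h))
    (fun ab => by
      refine aeval_mul_aeval_monomial_mem_span hF he hk hxh _ _ ?_
      rw [← hUT, add_mul]
      exact Nat.add_le_add (degree_le_of_mem_boxExponents ab.1.2)
        (degree_le_of_mem_boxExponents ab.2.2))
    (by
      refine (card_boundedProducts_le _ _ _ _).trans_lt ?_
      rw [Fintype.card_prod, Fintype.card_coe, Fintype.card_coe, card_boxExponents,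
        card_boxExponents, ← pow_add, hUT, pow_succ']
      -- The spanning set grows like `m ^ n` and the number of monomials is `(m + 1) ^ (n + 1)`;
      -- `hm` is exactly what makes the latter larger.
      calc (k + e) ^ n * ((n + 1) * m + 1) ^ n ≤ (k + e) ^ n * ((n + 1) * (m + 1)) ^ n :=
            Nat.mul_le_mul_left _ (Nat.pow_le_pow_left (by nlinarith) _)
        _ = ((n + 1) * (k + e)) ^ n * (m + 1) ^ n := by rw [mul_pow, mul_pow]; ring
        _ < (m + 1) * (m + 1) ^ n :=
            Nat.mul_lt_mul_of_pos_right (Nat.lt_succ_of_le hm) (by positivity))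
  refine ⟨c, hc, fun x' h' hxh' => ?_⟩
  have := congrFun hc0 ⟨(x', h'), hxh'⟩
  simpa [hx, hh] using this

/-- If `card σ + 1 - card T` coordinates are independent on a set on which `Hess F(x) h = 0`, then
`h` is a zero of a nonzero polynomial of bounded degree in the coordinates in `T`. -/
theorem exists_polynomial_vanishing_of_independent {σ K : Type*} [Fintype σ] [Field K] {e k m : ℕ}
    {F : MvPolynomial σ K} (hF : F.IsHomogeneous (e + 1)) (he : (e : K) ≠ 0)
    (hk : ∀ i, (X i : MvPolynomial σ K) ^ (k + e) ∈ Ideal.span (Set.range fun j => pderiv j F))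
    (hm : ((Fintype.card σ + 1) * (k + e)) ^ Fintype.card σ ≤ m)
    (U T : Finset σ) (hUT : U.card + T.card = Fintype.card σ + 1) :
    ∃ q : MvPolynomial σ K, q ≠ 0 ∧ (∀ a ∈ q.support, a.support ⊆ T ∧ ∀ i, a i ≤ m) ∧
      ∀ (h : σ → K) (V : Set (σ → K)),
        (∀ x ∈ V, ∀ i, ∑ j, h j * eval x (pderiv j (pderiv i F)) = 0) →
        (∀ P ∈ vanishingIdeal K V, (∀ a ∈ P.support, a.support ⊆ U) → P = 0) → eval h q = 0 := by
  classical
  obtain ⟨c, ⟨⟨a₀, b₀⟩, hc⟩, hrel⟩ := exists_relation_of_hessian hF he hk hm U T hUT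
  -- The relation is read as a polynomial in the `U`-coordinates of `x` whose coefficients `q a` are
  -- polynomials in `h`. For fixed `h`, independence on `V` forces every `q a` to vanish at `h`;
  -- `a₀` is chosen so that `q a₀ ≠ 0`.
  let q : boxExponents U m → MvPolynomial σ K := fun a =>
    ∑ b : boxExponents T m, monomial (b : σ →₀ ℕ) (c (a, b))
  have hsum : ∀ {W : Finset (σ →₀ ℕ)} (f : W → K) (a : W),
      coeff a (∑ b : W, monomial (b : σ →₀ ℕ) (f b)) = f a := by
    intro W f a
    simp only [coeff_sum, coeff_monomial, Subtype.coe_inj]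
    simp
  have hsupp : ∀ {W : Finset (σ →₀ ℕ)} (f : W → K),
      ∀ a ∈ (∑ b : W, monomial (b : σ →₀ ℕ) (f b)).support, a ∈ W := by
    intro W f a ha
    obtain ⟨b, -, hb⟩ := Finset.mem_biUnion.1 (support_sum ha)
    have := support_monomial_subset hb
    rw [Finset.mem_singleton] at this
    exact this ▸ b.2
  refine ⟨q a₀, fun h0 => hc ?_, fun b hb => ?_, fun h V hV hind => ?_⟩
  · rw [← hsum (fun b => c (a₀, b)) b₀]
    exact congrArg (coeff _) h0
  · have := hsupp _ b hb
    exact ⟨support_subset_of_mem_boxExponents this, apply_le_of_mem_boxExponents this⟩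
  · have h0 := hind (∑ a : boxExponents U m, monomial (a : σ →₀ ℕ) (eval h (q a))) ?_ ?_
    · rw [← hsum (fun a => eval h (q a)) a₀, h0, coeff_zero]
    · intro x hx
      rw [← hrel x h (hV x hx), Fintype.sum_prod_type]
      simp only [map_sum, aeval_monomial, eval_monomial, q]
      refine Finset.sum_congr rfl fun a _ => Finset.sum_congr rfl fun b _ => ?_
      simp
      ring
    · exact fun a ha => support_subset_of_mem_boxExponents (hsupp _ a ha)

theorem MvPolynomial.pderiv_pderiv_comm {σ K : Type*} [CommRing K] (i j : σ) (P : MvPolynomial σ K) :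
    pderiv i (pderiv j P) = pderiv j (pderiv i P) := by
  classical
  have : ⁅(pderiv i : Derivation K (MvPolynomial σ K) (MvPolynomial σ K)),
      (pderiv j : Derivation K (MvPolynomial σ K) (MvPolynomial σ K))⁆ = 0 := by
    refine MvPolynomial.derivation_ext fun k => ?_
    rw [Derivation.commutator_apply, pderiv_X, pderiv_X]
    simp [Pi.single_apply, apply_ite]
  have h := DFunLike.congr_fun this P
  rwa [Derivation.commutator_apply, Derivation.zero_apply, sub_eq_zero] at h

/-! ### Reduction of boxes modulo `p`. -/

/-- An interval of `2 * H + 1` integers contains at most `2 * H / p + 1` elements of a residue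
class modulo `p`. -/
theorem card_filter_intCast_eq_le {K : Type*} [Field K] [DecidableEq K] (p H : ℕ) [CharP K p]
    (hp : 0 < p) (c : K) :
    ((Finset.Icc (-(H : ℤ)) H).filter fun z : ℤ => (z : K) = c).card ≤ 2 * H / p + 1 := by
  rw [← Finset.card_range (2 * H / p + 1)]
  have hp' : (0 : ℤ) < p := by exact_mod_cast hp
  -- Within a residue class, `z` is determined by the quotient of `z + H` by `p`.
  refine Finset.card_le_card_of_injOn (fun z => ((z + H) / p).toNat) ?_ ?_
  · intro z hz
    simp only [Finset.coe_filter, Finset.mem_Icc, Set.mem_ofPred_eq] at hz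
    have h1 : (z + H) / p ≤ (2 * H : ℤ) / p := Int.ediv_le_ediv hp' (by omega)
    have h2 : ((2 * H / p : ℕ) : ℤ) = (2 * H : ℤ) / p := by push_cast; rfl
    simpa [Nat.lt_succ_iff] using Int.toNat_le.2 (h1.trans_eq h2.symm)
  · intro z hz w hw hzw
    simp only [Finset.coe_filter, Finset.mem_Icc, Set.mem_ofPred_eq] at hz hw
    have h0z : 0 ≤ (z + H) / p := Int.ediv_nonneg (by omega) hp'.le
    have h0w : 0 ≤ (w + H) / p := Int.ediv_nonneg (by omega) hp'.le
    have hdiv : (z + H) / p = (w + H) / p := by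
      have : ((z + H) / p).toNat = ((w + H) / p).toNat := hzw
      omega
    have hmod : (z + H) % p = (w + H) % p := by
      have : (z : K) = w := hz.2.trans hw.2.symm
      exact Int.ModEq.add_right _ ((CharP.intCast_eq_intCast K p).1 this)
    have h1 := Int.mul_ediv_add_emod (z + H) p
    have h2 := Int.mul_ediv_add_emod (w + H) p
    rw [hdiv, hmod] at h1
    omega

theorem card_image_intCast_le {K : Type*} [Field K] [DecidableEq K] (p : ℕ) [Fact p.Prime]
    [CharP K p] (A : Finset ℤ) : (A.image fun z : ℤ => (z : K)).card ≤ p := by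
  let f : ZMod p → K := ZMod.castHom dvd_rfl K
  have : (A.image fun z : ℤ => (z : K)) ⊆ (Finset.univ : Finset (ZMod p)).image f := by
    intro x hx
    obtain ⟨z, -, rfl⟩ := Finset.mem_image.1 hx
    exact Finset.mem_image.2 ⟨(z : ZMod p), Finset.mem_univ _, by simp [f]⟩
  refine (Finset.card_le_card this).trans (Finset.card_image_le.trans ?_)
  simp [ZMod.card]

/-- Passing from points of a box of integers to their reductions modulo `p`. -/
theorem card_le_card_image_intCast_mul {K : Type*} [Field K] [DecidableEq K] (p H : ℕ) [CharP K p]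
    (hp : 0 < p) {n : ℕ} (A : Finset (Fin n → ℤ))
    (hA : ∀ h ∈ A, ∀ i, -(H : ℤ) ≤ h i ∧ h i ≤ (H : ℤ)) :
    A.card ≤ (2 * H / p + 1) ^ n * (A.image fun h i => (h i : K)).card := by
  refine Finset.card_le_mul_card_image A _ fun x _ => ?_
  calc (A.filter fun h => (fun i => (h i : K)) = x).card
      ≤ (Fintype.piFinset fun i => (Finset.Icc (-(H : ℤ)) H).filter fun z : ℤ => (z : K) = x i).card := by
        refine Finset.card_le_card fun h hh => ?_
        rw [Finset.mem_filter] at hh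
        refine Fintype.mem_piFinset.2 fun i => ?_
        rw [Finset.mem_filter, Finset.mem_Icc]
        exact ⟨hA h hh.1 i, congrFun hh.2 i⟩
    _ ≤ ∏ _i : Fin n, (2 * H / p + 1) := by
        rw [Fintype.card_piFinset]
        exact Finset.prod_le_prod' fun i _ => card_filter_intCast_eq_le p H hp (x i)
    _ = (2 * H / p + 1) ^ n := by simp

/-- Sizes of boxes modulo `p`: a box with sides shorter than `p` injects, and a larger box covers
all residues about `H / p` times. -/
theorem box_card_pow_mul_pow_le {p H n s S : ℕ} (hp : 0 < p) (hH : 0 < H) (hs : s ≤ n) (hSp : S ≤ p)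
    (hSH : S ≤ 2 * H + 1) :
    (((2 * H / p + 1) ^ n * S ^ (n - s) : ℕ) : ℝ) ≤
      4 ^ n * ((H : ℝ) ^ (n - s) + (H : ℝ) ^ n / (p : ℝ) ^ s) := by
  have hp' : (0 : ℝ) < p := by exact_mod_cast hp
  rcases lt_or_ge (2 * H) p with h | h
  · rw [Nat.div_eq_of_lt h, zero_add, one_pow, one_mul]
    have h1 : (S : ℝ) ≤ 4 * H := by exact_mod_cast (by omega : S ≤ 4 * H)
    calc ((S ^ (n - s) : ℕ) : ℝ) ≤ (4 * H) ^ (n - s) := by push_cast; gcongr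
      _ = 4 ^ (n - s) * (H : ℝ) ^ (n - s) := mul_pow _ _ _
      _ ≤ 4 ^ n * (H : ℝ) ^ (n - s) := by gcongr; norm_num; omega
      _ ≤ _ := by gcongr; exact le_add_of_nonneg_right (by positivity)
  · have h1 : ((2 * H / p + 1 : ℕ) : ℝ) ≤ 4 * H / p := by
      rw [le_div_iff₀ hp']
      have := Nat.div_mul_le_self (2 * H) p
      exact_mod_cast (by nlinarith : (2 * H / p + 1) * p ≤ 4 * H)
    have hpn : (p : ℝ) ^ n = p ^ s * p ^ (n - s) := by rw [← pow_add, Nat.add_sub_cancel' hs]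
    calc (((2 * H / p + 1) ^ n * S ^ (n - s) : ℕ) : ℝ)
        = ((2 * H / p + 1 : ℕ) : ℝ) ^ n * (S : ℝ) ^ (n - s) := by push_cast; rfl
      _ ≤ (4 * H / p) ^ n * (p : ℝ) ^ (n - s) := by gcongr
      _ = 4 ^ n * ((H : ℝ) ^ n / (p : ℝ) ^ s) := by
          rw [div_pow, mul_pow, hpn]; field_simp
      _ ≤ _ := by gcongr; exact le_add_of_nonneg_left (by positivity)

/-! ### Singular loci of `h · ∇F` and the final count. -/

theorem eval_map_algebraMap_eq_aeval {σ k K : Type*} [Field k] [Field K] [Algebra k K] (x : σ → K)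
    (P : MvPolynomial σ k) : eval x (map (algebraMap k K) P) = aeval x P := by
  rw [eval_map, aeval_def]

/-- The gradient of `h · ∇F` is `Hess F` applied to `h`, by symmetry of second derivatives. -/
theorem sum_mul_hessian_eq_zero_of_mem_singularLocus {p n : ℕ} [Fact p.Prime] {h : Fin n → ℤ}
    {F : MvPolynomial (Fin n) (ZMod p)} {x : Fin n → AlgebraicClosure (ZMod p)}
    (hx : x ∈ singularLocus (dotGrad h F)) (i : Fin n) :
    ∑ j, (h j : AlgebraicClosure (ZMod p)) *
      eval x (pderiv j (pderiv i (map (algebraMap _ (AlgebraicClosure (ZMod p))) F))) = 0 := by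
  rw [← hx.2 i, dotGrad, map_sum, map_sum]
  refine Finset.sum_congr rfl fun j _ => ?_
  rw [pderiv_map, pderiv_map, eval_map_algebraMap_eq_aeval, pderiv_C_mul, map_mul, aeval_C,
    map_intCast, pderiv_pderiv_comm]

/-- In large characteristic the partial derivatives of a nonsingular form have no nontrivial
common zero. -/
theorem IsNonsingularForm.eq_zero_of_eval_pderiv_eq_zero {k : Type*} [Field k] {n d : ℕ}
    {F : MvPolynomial (Fin n) k} (hF : F.IsHomogeneous d) (hns : IsNonsingularForm F)
    (hd : (d : k) ≠ 0) (x : Fin n → AlgebraicClosure k)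
    (hx : ∀ j, eval x (pderiv j (map (algebraMap k (AlgebraicClosure k)) F)) = 0) : x = 0 := by
  have hx' : ∀ j, aeval x (pderiv j F) = 0 := fun j => by
    rw [← eval_map_algebraMap_eq_aeval, ← pderiv_map, hx j]
  refine hns x ?_ hx'
  -- By Euler's formula `d • F` vanishes where the gradient does, and `d` is invertible in `k`.
  have := congrArg (aeval x) hF.sum_X_mul_pderiv
  simp only [map_sum, map_mul, hx', mul_zero, Finset.sum_const_zero, map_nsmul] at this
  rw [← Nat.cast_smul_eq_nsmul k] at this
  exact (smul_eq_zero.1 this.symm).resolve_left hd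

theorem card_le_three_mul_pow {H n : ℕ} (hH : 0 < H) (A : Finset (Fin n → ℤ))
    (hA : ∀ h ∈ A, ∀ i, -(H : ℤ) ≤ h i ∧ h i ≤ (H : ℤ)) : A.card ≤ (3 * H) ^ n := by
  have h1 : A ⊆ Fintype.piFinset fun _ => Finset.Icc (-(H : ℤ)) H := fun h hh =>
    Fintype.mem_piFinset.2 fun i => Finset.mem_Icc.2 (hA h hh i)
  refine (Finset.card_le_card h1).trans ?_
  rw [Fintype.card_piFinset]
  simp only [Int.card_Icc, Finset.prod_const, Finset.card_univ, Fintype.card_fin]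
  exact Nat.pow_le_pow_left (by omega) _

/-- The count of the vectors `h` in a box such that the singular locus of `h · ∇F` has dimension
`s`, when the characteristic exceeds the degree of `F`. -/
theorem card_le_of_affineDim_singularLocus_eq {n e p H s m : ℕ} [Fact p.Prime] (hp : e + 1 < p)
    (he : 0 < e) {F : MvPolynomial (Fin n) (ZMod p)} (hF : F.IsHomogeneous (e + 1))
    (hns : IsNonsingularForm F) (hH : 0 < H) (hs : s ≤ n)
    (hm : ((n + 1) * ((n * e + 1) ^ n + e)) ^ n ≤ m) (A : Finset (Fin n → ℤ))
    (hA : ∀ h ∈ A, ∀ i, -(H : ℤ) ≤ h i ∧ h i ≤ (H : ℤ))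
    (hdim : ∀ h ∈ A, affineDim (singularLocus (dotGrad h F)) = (s : WithBot ℕ∞)) :
    (A.card : ℝ) ≤ 2 ^ n * (2 ^ n * (m + 1) ^ n * 4 ^ n) *
      ((H : ℝ) ^ (n - s) + (H : ℝ) ^ n / (p : ℝ) ^ s) := by
  classical
  let K := AlgebraicClosure (ZMod p)
  have : CharP K p := charP_of_injective_algebraMap (algebraMap (ZMod p) K).injective p
  have hp0 : 0 < p := (Fact.out : p.Prime).pos
  have hcast : ∀ (k : Type) [Field k] [CharP k p] (a : ℕ), 0 < a → a < p → (a : k) ≠ 0 := by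
    intro k _ _ a ha hap h
    exact absurd (Nat.le_of_dvd ha ((CharP.cast_eq_zero_iff k p a).1 h)) (not_le.2 hap)
  let F' : MvPolynomial (Fin n) K := map (algebraMap (ZMod p) K) F
  have hF' : F'.IsHomogeneous (e + 1) := hF.map _
  have hk : ∀ i, (X i : MvPolynomial (Fin n) K) ^ ((n * e + 1) ^ n + e) ∈
      Ideal.span (Set.range fun j => pderiv j F') := by
    intro i
    have := pow_mem_span_of_forall_eq_zero he rfl (fun j => pderiv j F')
      (fun j => hF'.pderiv)
      (hns.eq_zero_of_eval_pderiv_eq_zero hF (hcast (ZMod p) _ (Nat.succ_pos e) hp)) i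
    rw [Fintype.card_fin] at this
    exact Ideal.pow_mem_of_pow_mem _ this (Nat.le_add_right _ _)
  -- The coordinates in `U` are algebraically independent on the singular locus. Each `h ∈ A` is
  -- good for some `U` of size `s`, and each `U` is counted separately.
  let good : Finset (Fin n) → (Fin n → ℤ) → Prop := fun U h =>
    ∀ P ∈ vanishingIdeal K (singularLocus (dotGrad h F)), (∀ a ∈ P.support, a.support ⊆ U) → P = 0
  let S : Finset K := (Finset.Icc (-(H : ℤ)) H).image fun z : ℤ => (z : K)
  have hSp : S.card ≤ p := card_image_intCast_le p _
  have hSH : S.card ≤ 2 * H + 1 := by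
    refine Finset.card_image_le.trans ?_
    rw [Int.card_Icc]; omega
  have hU : ∀ U ∈ Finset.powersetCard s (Finset.univ : Finset (Fin n)),
      (((A.filter (good U)).card : ℕ) : ℝ) ≤ (2 ^ n * (m + 1) ^ n * 4 ^ n) *
        ((H : ℝ) ^ (n - s) + (H : ℝ) ^ n / (p : ℝ) ^ s) := by
    intro U hUs
    have hUs := (Finset.mem_powersetCard.1 hUs).2
    have h1 := card_le_card_image_intCast_mul (K := K) p H hp0 (A.filter (good U))
      fun h hh => hA h (Finset.mem_filter.1 hh).1
    have h2 := card_le_of_vanishing_coordinate_polynomials (m := m) (Nat.sub_le n s) S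
      ((A.filter (good U)).image fun h i => (h i : K))
      (by
        intro x hx i
        obtain ⟨h, hh, rfl⟩ := Finset.mem_image.1 hx
        exact Finset.mem_image.2 ⟨h i, Finset.mem_Icc.2 (hA h (Finset.mem_filter.1 hh).1 i), rfl⟩)
      (by
        intro T hT
        obtain ⟨q, hq0, hqs, hq⟩ := exists_polynomial_vanishing_of_independent hF'
          (hcast K e he (by omega)) hk (by simpa using hm) U T
          (by rw [Fintype.card_fin, hUs, hT]; omega)
        refine ⟨q, hq0, hqs, fun x hx => ?_⟩
        obtain ⟨h, hh, rfl⟩ := Finset.mem_image.1 hx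
        exact hq _ (singularLocus (dotGrad h F))
          (fun x hx => sum_mul_hessian_eq_zero_of_mem_singularLocus hx)
          (Finset.mem_filter.1 hh).2)
    have h3 := box_card_pow_mul_pow_le hp0 hH hs hSp hSH
    calc ((A.filter (good U)).card : ℝ)
        ≤ (((2 * H / p + 1) ^ n * (2 ^ n * ((m + 1) ^ n * S.card ^ (n - s))) : ℕ) : ℝ) := by
          exact_mod_cast h1.trans (Nat.mul_le_mul_left _ h2)
      _ = 2 ^ n * (m + 1) ^ n * (((2 * H / p + 1) ^ n * S.card ^ (n - s) : ℕ) : ℝ) := by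
          push_cast; ring
      _ ≤ 2 ^ n * (m + 1) ^ n * (4 ^ n * ((H : ℝ) ^ (n - s) + (H : ℝ) ^ n / (p : ℝ) ^ s)) := by
          gcongr
      _ = _ := by ring
  have hcover : A ⊆ (Finset.powersetCard s (Finset.univ : Finset (Fin n))).biUnion
      fun U => A.filter (good U) := by
    intro h hh
    obtain ⟨U, hUs, hind⟩ := exists_independent_coordinates
      (vanishingIdeal K (singularLocus (dotGrad h F))) (hdim h hh).ge
    exact Finset.mem_biUnion.2 ⟨U, by simpa using hUs, Finset.mem_filter.2 ⟨hh, hind⟩⟩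
  set E := (H : ℝ) ^ (n - s) + (H : ℝ) ^ n / (p : ℝ) ^ s with hE
  calc (A.card : ℝ) ≤ ∑ U ∈ Finset.powersetCard s (Finset.univ : Finset (Fin n)),
        ((A.filter (good U)).card : ℝ) := by
        exact_mod_cast (Finset.card_le_card hcover).trans Finset.card_biUnion_le
    _ ≤ (n.choose s : ℝ) * ((2 ^ n * (m + 1) ^ n * 4 ^ n) * E) := by
        simpa using Finset.sum_le_card_nsmul _ _ _ hU
    _ ≤ 2 ^ n * ((2 ^ n * (m + 1) ^ n * 4 ^ n) * E) := by
        gcongr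
        exact_mod_cast Nat.choose_le_two_pow n s
    _ = _ := by ring

theorem lemma3p2 (n d : ℕ) (hd : 2 ≤ d) :
    ∃ C : ℝ, ∀ (p : ℕ) [Fact p.Prime] (F : MvPolynomial (Fin n) (ZMod p)),
      F.IsHomogeneous d → IsNonsingularForm F →
      ∀ H : ℕ, 0 < H → ∀ s : ℕ, s ≤ n →
        (Set.ncard {h : Fin n → ℤ | h ≠ 0 ∧ (∀ i, -(H : ℤ) ≤ h i ∧ h i ≤ (H : ℤ)) ∧
            affineDim (singularLocus (dotGrad h F)) = (s : WithBot ℕ∞)} : ℝ) ≤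
          C * ((H : ℝ) ^ (n - s) + (H : ℝ) ^ n / (p : ℝ) ^ s) := by
  classical
  obtain ⟨e, rfl⟩ : ∃ e, d = e + 1 := ⟨d - 1, by omega⟩
  set m := ((n + 1) * ((n * e + 1) ^ n + e)) ^ n with hm
  -- The first summand serves the primes `p ≤ d`, where `p ^ s ≤ d ^ n` and the box has at most `(3
  -- * H) ^ n` points; the second serves `p > d`.
  refine ⟨3 ^ n * (e + 1) ^ n + 2 ^ n * (2 ^ n * (m + 1) ^ n * 4 ^ n), ?_⟩
  intro p _ F hF hns H hH s hs
  set Z := {h : Fin n → ℤ | h ≠ 0 ∧ (∀ i, -(H : ℤ) ≤ h i ∧ h i ≤ (H : ℤ)) ∧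
    affineDim (singularLocus (dotGrad h F)) = (s : WithBot ℕ∞)} with hZ
  have hfin : Z.Finite := (Set.finite_Icc (fun _ => -(H : ℤ)) fun _ => (H : ℤ)).subset
    fun h hh => ⟨fun i => (hh.2.1 i).1, fun i => (hh.2.1 i).2⟩
  have hp0 : (0 : ℝ) < p := by exact_mod_cast (Fact.out : p.Prime).pos
  have hbox : ∀ h ∈ hfin.toFinset, ∀ i, -(H : ℤ) ≤ h i ∧ h i ≤ (H : ℤ) :=
    fun h hh => ((hfin.mem_toFinset).1 hh).2.1
  rw [Set.ncard_eq_toFinset_card Z hfin]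
  by_cases hsmall : p ≤ e + 1
  · have hps : (p : ℝ) ^ s ≤ (e + 1 : ℝ) ^ n := by
      have : (p : ℝ) ≤ e + 1 := by exact_mod_cast hsmall
      calc (p : ℝ) ^ s ≤ (e + 1 : ℝ) ^ s := by gcongr
        _ ≤ _ := pow_le_pow_right₀ (by simp) hs
    calc (hfin.toFinset.card : ℝ) ≤ ((3 * H) ^ n : ℕ) := by
          exact_mod_cast card_le_three_mul_pow hH _ hbox
      _ = 3 ^ n * (H : ℝ) ^ n := by push_cast; rw [mul_pow]
      _ = 3 ^ n * ((p : ℝ) ^ s * ((H : ℝ) ^ n / (p : ℝ) ^ s)) := by field_simp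
      _ ≤ 3 ^ n * ((e + 1 : ℝ) ^ n * ((H : ℝ) ^ n / (p : ℝ) ^ s)) := by gcongr
      _ ≤ 3 ^ n * ((e + 1 : ℝ) ^ n * ((H : ℝ) ^ (n - s) + (H : ℝ) ^ n / (p : ℝ) ^ s)) := by
          gcongr; exact le_add_of_nonneg_left (by positivity)
      _ = 3 ^ n * (e + 1 : ℝ) ^ n * ((H : ℝ) ^ (n - s) + (H : ℝ) ^ n / (p : ℝ) ^ s) := by ring
      _ ≤ _ := by gcongr; exact le_add_of_nonneg_right (by positivity)
  · push Not at hsmall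
    refine (card_le_of_affineDim_singularLocus_eq hsmall (by omega) hF hns hH hs hm.ge _ hbox
      fun h hh => ((hfin.mem_toFinset).1 hh).2.2).trans ?_
    gcongr
    exact le_add_of_nonneg_left (by positivity)
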